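/- Let $T$ be a commutative Noetherian local ring with maximal ideal $M$. Suppose that $T$ is complete with respect to the $M$-adic topology (complete and separated) and that the Krull dimension of $T$ is at least $2$. Then the following are equivalent. (a) There is a Noetherian local integral domain $A$, with maximal ideal $\mathfrak m$, whose $\mathfrak m$-adic completion $\widehat{A}=\varprojlim_n A/\mathfrak m^n$ is isomorphic as a ring to $T$ and which satisfies $|\operatorname{Spec}(A)|<|\operatorname{Spec}(T)|$. (b) The following three conditions hold: (i) no integer of $T$ is a zerodivisor, that is, for every $n\in\mathbb Z$ with $n\cdot 1_T\neq 0$, the element $n\cdot 1_T$ is not a zerodivisor of $T$; (ii) $M\notin\operatorname{Ass}(T)$, that is, $M$ is not an associated prime of $T$ as a $T$-module; (iii) $|T/M|<|T|$. Here $|\cdot|$ denotes cardinality. -/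

import Mathlib

universe u

open IsLocalRing Cardinal

/-! Write k = T/M and κ = max(|k|, ℵ₀). Necessity: completion is flat, so nonzero elements of A stay
regular in T; this gives (i), and also (ii), since M = 𝔪T and 𝔪 ≠ 0. A pencil x + uy, with u over
residue representatives, produces |k| distinct primes of A, while |Spec T| ≤ |T| because T is
infinite and its ideals are finitely generated. Hence |T| ≤ |k| would contradict |Spec A| < |Spec
T|. Sufficiency: (iii) forces κ < |k|^ℵ₀, and a prime avoidance argument in the complete ring T
gives |k|^ℵ₀ ≤ |Spec T|. It therefore suffices to find a Noetherian local domain A ⊆ T of size at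
most κ with completion T. Starting from the prime subring, generic elements are adjoined, keeping
nonzero elements regular, until A is dense and closed under solving linear congruences. That closure
yields IT ∩ A = I for every ideal I of A, from which Noetherianity, locality and the completion
follow. -/

/-! ### Bounds on the number of primes -/

theorem maximalIdeal_notMem_minimalPrimes_span_singleton {R : Type*} [CommRing R]
    [IsNoetherianRing R] [IsLocalRing R] (hdim : 2 ≤ ringKrullDim R) (x : R) :
    maximalIdeal R ∉ (Ideal.span {x}).minimalPrimes := by
  intro h
  have h1 := Ideal.height_le_one_of_isPrincipal_of_mem_minimalPrimes _ _ h
  rw [← maximalIdeal_height_eq_ringKrullDim] at hdim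
  have h2 : (2 : ℕ∞) ≤ (maximalIdeal R).height := WithBot.coe_le_coe.1 hdim
  have h3 : (2 : ℕ∞) ≤ 1 := h2.trans h1
  exact absurd h3 (by decide)

theorem Cardinal.mk_primeSpectrum_le_max {R : Type u} [CommRing R] [IsNoetherianRing R] :
    #(PrimeSpectrum R) ≤ max #R ℵ₀ := by
  have hsurj : Function.Surjective (fun s : Finset R => Ideal.span (s : Set R)) := fun I =>
    (I.fg_of_isNoetherianRing : I.FG)
  have h1 : #(PrimeSpectrum R) ≤ #(Ideal R) :=
    mk_le_of_injective (f := PrimeSpectrum.asIdeal) fun _ _ => PrimeSpectrum.ext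
  refine (h1.trans (mk_le_of_surjective hsurj)).trans ?_
  cases finite_or_infinite R
  · exact (mk_lt_aleph0 (α := Finset R)).le.trans (le_max_right _ _)
  · rw [mk_finset_of_infinite]
    exact le_max_left _ _

/-- Prime avoidance gives x ≠ 0 and y in 𝔪 with no prime of height at most 1 containing both.
Minimal primes over x + uy have height at most 1; one shared by two residue classes of u would
contain y, as the difference of the two u is a unit, and hence x. The hypothesis `h` is the form of
"dimension at least 2" that descends from T without comparing dimensions. -/
theorem mk_residue_le_mk_primeSpectrum {A : Type u} [CommRing A] [IsDomain A]
    [IsNoetherianRing A] [IsLocalRing A]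
    (h : ∀ x : A, maximalIdeal A ∉ (Ideal.span {x}).minimalPrimes) :
    #(A ⧸ maximalIdeal A) ≤ #(PrimeSpectrum A) := by
  have hmin : ∀ x : A, ∃ y ∈ maximalIdeal A, ∀ P ∈ (Ideal.span {x}).minimalPrimes, y ∉ P := by
    intro x
    by_contra! hc
    have hsub : (maximalIdeal A : Set A) ⊆ ⋃ P ∈ (Ideal.span {x}).minimalPrimes, (P : Set A) :=
      fun y hy => by simpa using hc y hy
    obtain ⟨P, hP, hle⟩ := (Ideal.subset_union_prime_finite
      (Ideal.finite_minimalPrimes_of_isNoetherianRing A (Ideal.span {x})) (f := id) 0 0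
      fun _ hP _ _ => hP.1.1).1 hsub
    have hPm : P = maximalIdeal A := le_antisymm (le_maximalIdeal hP.1.1.ne_top) hle
    exact h x (hPm ▸ hP)
  obtain ⟨x, hxm, hx⟩ := hmin 0
  have hx0 : x ≠ 0 := by
    rintro rfl
    obtain ⟨P, hP⟩ := (Ideal.span {(0 : A)}).nonempty_minimalPrimes (by simp)
    exact hx P hP P.zero_mem
  obtain ⟨y, hym, hy⟩ := hmin x
  have hxy : ∀ P : Ideal A, P.IsPrime → P.height ≤ 1 → x ∈ P → y ∉ P := by
    intro P hP hht hxP hyP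
    refine hy P (Ideal.mem_minimalPrimes_of_height_le
      ((Ideal.span_singleton_le_iff_mem _).2 hxP) (hht.trans ?_)) hyP
    exact Ideal.one_le_height_span_singleton_of_mem_nonZeroDivisors (mem_nonZeroDivisors_of_ne_zero hx0)
  let u : A ⧸ maximalIdeal A → A := Quotient.out
  have hu : ∀ q, Ideal.Quotient.mk (maximalIdeal A) (u q) = q := fun q => Quotient.out_eq q
  have hex : ∀ q, ∃ P : Ideal A, P ∈ (Ideal.span {x + u q * y}).minimalPrimes := fun q =>
    Set.nonempty_coe_sort.1 <| Ideal.nonempty_minimalPrimes (by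
      rw [Ne, Ideal.span_singleton_eq_top]
      exact fun hun => (mem_maximalIdeal _).1
        (add_mem hxm (Ideal.mul_mem_left _ _ hym)) hun)
  choose P hP using hex
  refine mk_le_of_injective (f := fun q => (⟨P q, (hP q).1.1⟩ : PrimeSpectrum A)) ?_
  intro q r hqr
  have hPP : P q = P r := congrArg PrimeSpectrum.asIdeal hqr
  by_contra hne
  have hht : (P q).height ≤ 1 := Ideal.height_le_one_of_isPrincipal_of_mem_minimalPrimes _ _ (hP q)
  have h1 : x + u q * y ∈ P q := (hP q).1.2 (Ideal.mem_span_singleton_self _)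
  have h2 : x + u r * y ∈ P q := hPP ▸ (hP r).1.2 (Ideal.mem_span_singleton_self _)
  have h3 : (u q - u r) * y ∈ P q := by
    have := sub_mem h1 h2
    rwa [show x + u q * y - (x + u r * y) = (u q - u r) * y by ring] at this
  have hyP : y ∈ P q := by
    refine ((hP q).1.1.mem_or_mem h3).resolve_left fun h4 => hne ?_
    have h5 := le_maximalIdeal (hP q).1.1.ne_top h4
    rw [← hu q, ← hu r]
    exact Ideal.Quotient.eq.2 h5
  refine hxy _ (hP q).1.1 hht ?_ hyP
  have := sub_mem h1 (Ideal.mul_mem_left _ (u q) hyP)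
  rwa [add_sub_cancel_right] at this

theorem ringKrullDim_le_zero_of_finite {R : Type*} [CommRing R] [Nontrivial R] [Finite R] :
    ringKrullDim R ≤ 0 := by
  have : Ring.KrullDimLE 0 R := inferInstance
  exact Ring.krullDimLE_iff.1 this

/-! ### Necessity: comparing A with its completion -/

theorem map_maximalIdeal_of_adicCompletion_equiv {A T : Type*} [CommRing A] [IsNoetherianRing A]
    [IsLocalRing A] [CommRing T] [IsLocalRing T] (e : AdicCompletion (maximalIdeal A) A ≃+* T) :
    (maximalIdeal A).map
      (e.toRingHom.comp (algebraMap A (AdicCompletion (maximalIdeal A) A))) = maximalIdeal T := by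
  rw [← Ideal.map_map, ← AdicCompletion.maximalIdeal_eq_map]
  exact IsLocalRing.eq_maximalIdeal (Ideal.map_isMaximal_of_equiv e)

theorem mem_nonZeroDivisors_of_adicCompletion_equiv {A T : Type*} [CommRing A]
    [IsNoetherianRing A] [IsDomain A] [CommRing T] (I : Ideal A)
    (e : AdicCompletion I A ≃+* T) {a : A} (ha : a ≠ 0) :
    e (algebraMap A _ a) ∈ nonZeroDivisors T := by
  have h : IsSMulRegular (AdicCompletion I A) a :=
    Module.Flat.isSMulRegular_of_nonZeroDivisors (mem_nonZeroDivisors_of_ne_zero ha)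
  rw [mem_nonZeroDivisors_iff_right]
  intro x hx
  have h1 : a • e.symm x = a • (0 : AdicCompletion I A) := by
    apply e.injective
    rw [Algebra.smul_def, map_mul, e.apply_symm_apply, mul_comm, hx]
    simp
  have := h h1
  simpa using this

theorem mk_residue_eq_of_adicCompletion_equiv {A T : Type u} [CommRing A] [IsNoetherianRing A]
    [IsLocalRing A] [CommRing T] [IsLocalRing T] (e : AdicCompletion (maximalIdeal A) A ≃+* T) :
    #(T ⧸ maximalIdeal T) = #(A ⧸ maximalIdeal A) := by
  have h1 : #(ResidueField A) = #(ResidueField (AdicCompletion (maximalIdeal A) A)) :=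
    mk_congr (Equiv.ofBijective _ (AdicCompletion.residueField_map_bijective A))
  have h2 := mk_congr (ResidueField.mapEquiv e).toEquiv
  exact (h1.trans h2).symm

theorem residue_lt_of_mk_primeSpectrum_lt {T : Type u} [CommRing T] [IsNoetherianRing T]
    [IsLocalRing T] (hdim : 2 ≤ ringKrullDim T) {A : Type u} [CommRing A] [IsDomain A]
    [IsNoetherianRing A] [IsLocalRing A] (φ : A →+* T)
    (hmap : (maximalIdeal A).map φ = maximalIdeal T)
    (hreg : ∀ a, a ≠ 0 → φ a ∈ nonZeroDivisors T)
    (hres : #(T ⧸ maximalIdeal T) = #(A ⧸ maximalIdeal A))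
    (hcard : #(PrimeSpectrum A) < #(PrimeSpectrum T)) :
    (∀ n : ℤ, (n : T) ≠ 0 → (n : T) ∈ nonZeroDivisors T) ∧
      maximalIdeal T ∉ associatedPrimes T T ∧ #(T ⧸ maximalIdeal T) < #T := by
  -- A prime of T containing φ(x) contracts to a prime containing x. If 𝔪 were minimal over x, that
  -- contraction would be 𝔪, so M = 𝔪T would be minimal over φ(x).
  have hA : ∀ x : A, maximalIdeal A ∉ (Ideal.span {x}).minimalPrimes := by
    intro x hx
    refine maximalIdeal_notMem_minimalPrimes_span_singleton hdim (φ x) ⟨⟨inferInstance, ?_⟩, ?_⟩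
    · rw [Ideal.span_singleton_le_iff_mem, ← hmap]
      exact Ideal.mem_map_of_mem _ (hx.1.2 (Ideal.mem_span_singleton_self x))
    · rintro Q ⟨hQ, hxQ⟩ -
      rw [← hmap, Ideal.map_le_iff_le_comap]
      refine hx.2 ⟨hQ.comap φ, ?_⟩ (le_maximalIdeal (hQ.comap φ).ne_top)
      rw [Ideal.span_singleton_le_iff_mem] at hxQ ⊢
      exact hxQ
  refine ⟨fun n hn => ?_, fun hM => ?_, ?_⟩
  · have hn' : (n : A) ≠ 0 := fun h => hn (by rw [← map_intCast φ, h, map_zero])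
    simpa using hreg n hn'
  · obtain ⟨a, ham, ha⟩ : ∃ a ∈ maximalIdeal A, a ≠ 0 := by
      by_contra! hc
      refine hA 0 ⟨⟨inferInstance, by simp⟩, fun Q _ _ x hx => ?_⟩
      rw [hc x hx]
      exact Q.zero_mem
    have h2 : φ a ∈ maximalIdeal T := hmap ▸ Ideal.mem_map_of_mem φ ham
    have h4 : φ a ∈ (nonZeroDivisors T : Set T)ᶜ := by
      rw [← biUnion_associatedPrimes_eq_compl_nonZeroDivisors T]
      exact Set.mem_biUnion hM h2
    exact h4 (hreg a ha)
  · by_contra hlt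
    have hle : #T ≤ #(T ⧸ maximalIdeal T) := not_lt.1 hlt
    have hinf : Infinite T := by
      by_contra hfin
      rw [not_infinite_iff_finite] at hfin
      exact not_lt.2 (hdim.trans ringKrullDim_le_zero_of_finite) (by norm_num)
    have h1 : #(PrimeSpectrum T) ≤ #T :=
      mk_primeSpectrum_le_max.trans (max_le le_rfl (aleph0_le_mk T))
    have h2 := mk_residue_le_mk_primeSpectrum hA
    rw [← hres] at h2
    exact absurd hcard (not_lt.2 (h1.trans (hle.trans h2)))

/-! ### Series with residue coefficients and avoidance of many primes -/

section ResidueSeries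

variable {T : Type u} [CommRing T] [IsLocalRing T]

theorem eq_of_forall_sub_mem_pow [IsHausdorff (maximalIdeal T) T] {x y : T}
    (h : ∀ n, x - y ∈ maximalIdeal T ^ n) : x = y := by
  rw [← sub_eq_zero]
  refine IsHausdorff.haus ‹_› _ fun n => ?_
  rw [SModEq.zero, smul_eq_mul, Ideal.mul_top]
  exact h n

/-- A function `u ↦ ∑ uᵢ zⁱ` evaluating sequences of residue representatives at `z`,
characterised by its functional equation. -/
theorem exists_residueSeries [IsAdicComplete (maximalIdeal T) T] {z : T}
    (hz : z ∈ maximalIdeal T) :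
    ∃ G : (ℕ → T ⧸ maximalIdeal T) → T, ∀ u,
      G u = (u 0).out + z * G (fun n => u (n + 1)) := by
  have hex : ∀ u : ℕ → T ⧸ maximalIdeal T, ∃ L : T, ∀ n,
      (∑ i ∈ Finset.range n, (u i).out * z ^ i) - L ∈ maximalIdeal T ^ n := by
    intro u
    obtain ⟨L, hL⟩ := IsPrecomplete.prec (I := maximalIdeal T) (M := T) inferInstance
      (f := fun n => ∑ i ∈ Finset.range n, (u i).out * z ^ i) (by
        intro m n hmn
        rw [SModEq.sub_mem, smul_eq_mul, Ideal.mul_top, ← neg_sub, neg_mem_iff,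
          ← Finset.sum_Ico_eq_sub _ hmn]
        refine sum_mem fun i hi => Ideal.mul_mem_left _ _ ?_
        exact Ideal.pow_le_pow_right (Finset.mem_Ico.1 hi).1 (Ideal.pow_mem_pow hz i))
    refine ⟨L, fun n => ?_⟩
    have := hL n
    rwa [SModEq.sub_mem, smul_eq_mul, Ideal.mul_top] at this
  choose G hG using hex
  refine ⟨G, fun u => eq_of_forall_sub_mem_pow fun n => ?_⟩
  have h1 := Ideal.pow_le_pow_right n.le_succ (hG u (n + 1))
  have h2 := Ideal.mul_mem_left _ z (hG (fun n => u (n + 1)) n)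
  rw [Finset.sum_range_succ'] at h1
  have h3 := sub_mem h2 h1
  rw [mul_sub, Finset.mul_sum] at h3
  convert h3 using 1
  have : ∑ i ∈ Finset.range n, z * ((u (i + 1)).out * z ^ i) =
      ∑ i ∈ Finset.range n, (u (i + 1)).out * z ^ (i + 1) :=
    Finset.sum_congr rfl fun i _ => by ring
  rw [this]
  ring

/-- Reduction modulo M recovers the leading coefficient; z is then cancelled modulo P and the
argument repeats on the shifted sequences. -/
theorem residueSeries_injective_mod {z : T} (hz : z ∈ maximalIdeal T)
    {G : (ℕ → T ⧸ maximalIdeal T) → T}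
    (hG : ∀ u, G u = (u 0).out + z * G (fun n => u (n + 1)))
    {P : Ideal T} (hP : P.IsPrime) (hzP : z ∉ P) {u v : ℕ → T ⧸ maximalIdeal T}
    (huv : G u - G v ∈ P) : u = v := by
  have hhead : ∀ {u v : ℕ → T ⧸ maximalIdeal T}, G u - G v ∈ P → u 0 = v 0 := by
    intro u v huv
    have h1 := le_maximalIdeal hP.ne_top huv
    rw [hG u, hG v] at h1
    rw [← Quotient.out_eq (u 0), ← Quotient.out_eq (v 0)]
    refine Ideal.Quotient.eq.2 ?_
    have := sub_mem h1 (Ideal.mul_mem_right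
      (G (fun n => u (n + 1)) - G (fun n => v (n + 1))) _ hz)
    convert this using 1
    ring
  funext n
  induction n generalizing u v with
  | zero => exact hhead huv
  | succ n ih =>
    refine ih (u := fun n => u (n + 1)) (v := fun n => v (n + 1)) ?_
    have h0 := hhead huv
    rw [hG u, hG v, h0, add_sub_add_left_eq_sub, ← mul_sub] at huv
    exact (hP.mem_or_mem huv).resolve_left hzP

/-- At each new y, x is replaced by x + y(1 + xG(u)). If exactly one of x, y lies in P, the new
element is outside P for every u, since 1 + xG(u) ∉ P when x ∈ P. If neither does, P excludes at
most one u, and there are more sequences u than primes in C. -/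
theorem exists_mem_maximalIdeal_forall_notMem [IsAdicComplete (maximalIdeal T) T]
    (C : Set (Ideal T)) (hC : ∀ P ∈ C, P.IsPrime) (hcard : #C < #(ℕ → T ⧸ maximalIdeal T))
    (s : Finset T) (hs : ∀ y ∈ s, y ∈ maximalIdeal T) :
    ∃ x ∈ maximalIdeal T, ∀ P ∈ C, (∃ y ∈ s, y ∉ P) → x ∉ P := by
  classical
  induction s using Finset.induction_on with
  | empty => exact ⟨0, zero_mem _, by simp⟩
  | insert y s _ ih =>
    obtain ⟨x, hxm, hx⟩ := ih fun y hy => hs y (Finset.mem_insert_of_mem hy)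
    have hym := hs y (Finset.mem_insert_self _ _)
    obtain ⟨G, hG⟩ := exists_residueSeries hxm
    obtain ⟨u, hu⟩ : ∃ u, ∀ P ∈ C, x ∉ P → y ∉ P → x + y * (1 + x * G u) ∉ P := by
      by_contra! hc
      choose P hPC hxP hyP hP using hc
      refine not_le.2 hcard (mk_le_of_injective (f := fun u => (⟨P u, hPC u⟩ : C)) ?_)
      intro u v huv
      have hPP : P u = P v := congrArg Subtype.val huv
      have hpr := hC _ (hPC u)
      refine residueSeries_injective_mod hxm hG hpr (hxP u) ?_
      have h1 := sub_mem (hP u) (hPP ▸ hP v)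
      rw [show x + y * (1 + x * G u) - (x + y * (1 + x * G v)) = y * (x * (G u - G v)) by ring]
        at h1
      exact (hpr.mem_or_mem ((hpr.mem_or_mem h1).resolve_left (hyP u))).resolve_left (hxP u)
    refine ⟨x + y * (1 + x * G u), add_mem hxm (Ideal.mul_mem_right _ _ hym), ?_⟩
    rintro P hPC ⟨w, hw, hwP⟩ hmem
    have hpr := hC P hPC
    by_cases hxP : x ∈ P
    · have hyP : y ∉ P := by
        rcases Finset.mem_insert.1 hw with rfl | hws
        · exact hwP
        · exact absurd hxP (hx P hPC ⟨w, hws, hwP⟩)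
      have h1 := (hpr.mem_or_mem ((Ideal.add_mem_iff_right P hxP).1 hmem)).resolve_left hyP
      have h2 := (Ideal.add_mem_iff_left P (Ideal.mul_mem_right _ _ hxP)).1 h1
      exact hpr.ne_top ((Ideal.eq_top_iff_one P).2 h2)
    · by_cases hyP : y ∈ P
      · exact hxP ((Ideal.add_mem_iff_left P (Ideal.mul_mem_right _ _ hyP)).1 hmem)
      · exact hu P hPC hxP hyP hmem

end ResidueSeries

/-- With fewer primes, a single x ∈ M would avoid every nonmaximal prime, making M minimal over x.
-/
theorem mk_residue_sequences_le_mk_primeSpectrum {T : Type u} [CommRing T]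
    [IsNoetherianRing T] [IsLocalRing T] [IsAdicComplete (maximalIdeal T) T]
    (hdim : 2 ≤ ringKrullDim T) : #(ℕ → T ⧸ maximalIdeal T) ≤ #(PrimeSpectrum T) := by
  by_contra! hlt
  let C : Set (Ideal T) := {P | P.IsPrime ∧ P ≠ maximalIdeal T}
  have hC : #C ≤ #(PrimeSpectrum T) :=
    mk_le_of_injective (f := fun P : C => (⟨P.1, P.2.1⟩ : PrimeSpectrum T)) fun P Q h =>
      Subtype.ext (congrArg PrimeSpectrum.asIdeal h)
  obtain ⟨s, hs⟩ := (maximalIdeal T).fg_of_isNoetherianRing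
  obtain ⟨x, hxm, hx⟩ := exists_mem_maximalIdeal_forall_notMem C (fun P hP => hP.1)
    (hC.trans_lt hlt) s fun y hy => hs ▸ Ideal.subset_span hy
  refine maximalIdeal_notMem_minimalPrimes_span_singleton hdim x ⟨⟨inferInstance, ?_⟩, ?_⟩
  · rwa [Ideal.span_singleton_le_iff_mem]
  · rintro Q ⟨hQ, hxQ⟩ -
    rw [Ideal.span_singleton_le_iff_mem] at hxQ
    by_contra hle
    refine hx Q ⟨hQ, fun h => hle h.ge⟩ ?_ hxQ
    by_contra! hc
    exact hle (hs ▸ Ideal.span_le.2 hc)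

/-! ### Dense subrings and the cardinality of T -/

theorem Subring.exists_sub_mem_pow {T : Type*} [CommRing T] {I : Ideal T} (B : Subring T)
    {s : Set T} (hsB : s ⊆ B) (hs : Ideal.span s = I) (hB : ∀ t, ∃ b ∈ B, t - b ∈ I) (n : ℕ)
    (t : T) : ∃ b ∈ B, t - b ∈ I ^ n := by
  induction n generalizing t with
  | zero => exact ⟨0, B.zero_mem, by simp⟩
  | succ n ih =>
    -- Elements of I gain one order of accuracy: their coefficients need approximating only modulo I
    -- ^ n.
    have key : ∀ x ∈ Ideal.span s, ∃ b ∈ B, x - b ∈ I ^ (n + 1) := by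
      intro x hx
      induction hx using Submodule.span_induction with
      | mem x hx => exact ⟨x, hsB hx, by simp⟩
      | zero => exact ⟨0, B.zero_mem, by simp⟩
      | add x y _ _ hx hy =>
        obtain ⟨b, hb, hxb⟩ := hx
        obtain ⟨c, hc, hyc⟩ := hy
        exact ⟨b + c, B.add_mem hb hc, by rw [add_sub_add_comm]; exact add_mem hxb hyc⟩
      | smul a x hxs hx =>
        obtain ⟨b, hb, hxb⟩ := hx
        obtain ⟨c, hc, hac⟩ := ih a
        refine ⟨c * b, B.mul_mem hc hb, ?_⟩
        replace hxs : x ∈ I := hs ▸ hxs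
        rw [show a • x - c * b = (a - c) * x + c * (x - b) by simp; ring]
        exact add_mem (pow_succ I n ▸ Ideal.mul_mem_mul hac hxs) (Ideal.mul_mem_left _ _ hxb)
    obtain ⟨b, hb, htb⟩ := hB t
    obtain ⟨c, hc, h⟩ := key _ (hs ▸ htb)
    exact ⟨b + c, B.add_mem hb hc, by rwa [← sub_sub]⟩

theorem Subring.mk_closure_le {T : Type u} [CommRing T] (s : Set T) :
    #(Subring.closure s) ≤ max #s ℵ₀ := by
  have h := Algebra.lift_cardinalMk_adjoin_le ℤ s
  have h2 : (Algebra.adjoin ℤ s : Set T) = Subring.closure s := by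
    rw [Algebra.adjoin_int]; rfl
  have h3 : #(Algebra.adjoin ℤ s) = #(Subring.closure s) := mk_congr (Equiv.setCongr h2)
  rw [h3] at h
  simp only [mk_int, lift_aleph0, lift_uzero] at h
  exact h.trans (max_le (max_le (le_max_right _ _) (le_max_left _ _)) (le_max_right _ _))

/-- T embeds in the sequences of a dense subring of size at most κ, so |k| < |T| ≤ |k|^ℵ₀; Cantor's
theorem handles ℵ₀. -/
theorem mk_residue_sup_aleph0_lt_mk_sequences {T : Type u} [CommRing T]
    [IsNoetherianRing T] [IsLocalRing T] [IsAdicComplete (maximalIdeal T) T]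
    (h : #(T ⧸ maximalIdeal T) < #T) :
    max #(T ⧸ maximalIdeal T) ℵ₀ < #(ℕ → T ⧸ maximalIdeal T) := by
  set k := T ⧸ maximalIdeal T with hk
  have hpow : #(ℕ → k) = #k ^ ℵ₀ := by simp
  have hk2 : 2 ≤ #k := two_le_iff.2 ⟨0, 1, zero_ne_one⟩
  have hle : max #k ℵ₀ ≤ #k ^ ℵ₀ :=
    max_le (self_le_power _ one_le_aleph0) ((cantor' ℵ₀ (by exact lt_of_lt_of_le (by norm_num) hk2)).le)
  obtain ⟨s, hs⟩ := (maximalIdeal T).fg_of_isNoetherianRing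
  let S : Set T := Set.range (Quotient.out : k → T) ∪ s
  let B := Subring.closure S
  have hBcard : #B ≤ max #k ℵ₀ := by
    refine (Subring.mk_closure_le S).trans (max_le ?_ (le_max_right _ _))
    refine (mk_union_le _ _).trans ?_
    refine add_le_of_le (le_max_right _ _) (mk_range_le.trans (le_max_left _ _)) ?_
    exact (mk_lt_aleph0 (α := (s : Set T))).le.trans (le_max_right _ _)
  have hB := B.exists_sub_mem_pow (s := s) (fun x hx => Subring.subset_closure (Or.inr hx)) hs
    fun t => ⟨(Ideal.Quotient.mk (maximalIdeal T) t).out,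
      Subring.subset_closure (Or.inl ⟨_, rfl⟩),
      Ideal.Quotient.eq.1 (Quotient.out_eq (Ideal.Quotient.mk (maximalIdeal T) t)).symm⟩
  choose b hbB hb using hB
  have hT : #T ≤ #(ℕ → B) := by
    refine mk_le_of_injective (f := fun t n => (⟨b n t, hbB n t⟩ : B)) fun x y hxy => ?_
    refine eq_of_forall_sub_mem_pow fun n => ?_
    have h1 : b n x = b n y := congrArg Subtype.val (congrFun hxy n)
    have := sub_mem (hb n x) (hb n y)
    rwa [h1, sub_sub_sub_cancel_right] at this
  have hT' : #T ≤ #k ^ ℵ₀ := by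
    refine hT.trans ?_
    have : #(ℕ → B) = #B ^ ℵ₀ := by simp
    rw [this]
    refine (power_le_power_right (hBcard.trans hle)).trans ?_
    rw [← power_mul, aleph0_mul_aleph0]
  rw [hpow]
  refine max_lt (h.trans_le hT') (cantor' ℵ₀ (lt_of_lt_of_le (by norm_num) hk2))

/-! ### Subrings whose nonzero elements are regular -/

namespace Subring

/-- Every nonzero element of the subring is a nonzerodivisor of the ambient ring. -/
def NonzeroRegular {T : Type*} [CommRing T] (R : Subring T) : Prop :=
  ∀ r ∈ R, r ≠ 0 → r ∈ nonZeroDivisors T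

variable {T : Type u} [CommRing T]

theorem NonzeroRegular.mono {R S : Subring T} (hS : S.NonzeroRegular) (h : R ≤ S) :
    R.NonzeroRegular := fun r hr => hS r (h hr)

theorem exists_aeval_of_mem_closure_insert {R : Subring T} {t x : T}
    (hx : x ∈ closure (insert t (R : Set T))) : ∃ f : Polynomial R, Polynomial.aeval t f = x := by
  have hle : closure (insert t (R : Set T)) ≤ (Polynomial.aeval (R := R) t).toRingHom.range := by
    rw [closure_le, Set.insert_subset_iff]
    exact ⟨⟨Polynomial.X, by simp⟩, fun r hr => ⟨Polynomial.C ⟨r, hr⟩, by simp; rfl⟩⟩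
  exact hle hx

/-- A power of the regular element a clears denominators, so each nonzero element of R[t] divides a
nonzero element of R. -/
theorem NonzeroRegular.closure_insert_of_mul_mem {R : Subring T} (hR : R.NonzeroRegular) {a t : T}
    (ha : a ∈ R) (ha0 : a ≠ 0) (hat : a * t ∈ R) :
    (closure (insert t (R : Set T))).NonzeroRegular := by
  have key : ∀ x ∈ closure (insert t (R : Set T)), ∃ n : ℕ, a ^ n * x ∈ R := by
    intro x hx
    induction hx using closure_induction with
    | mem x hx =>
      rcases hx with rfl | hx
      · exact ⟨1, by simpa using hat⟩
      · exact ⟨0, by simpa using hx⟩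
    | zero => exact ⟨0, by simp⟩
    | one => exact ⟨0, by simp⟩
    | add x y _ _ hx hy =>
      obtain ⟨n, hn⟩ := hx
      obtain ⟨m, hm⟩ := hy
      refine ⟨n + m, ?_⟩
      rw [show a ^ (n + m) * (x + y) = a ^ m * (a ^ n * x) + a ^ n * (a ^ m * y) by ring]
      exact R.add_mem (R.mul_mem (R.pow_mem ha _) hn) (R.mul_mem (R.pow_mem ha _) hm)
    | neg x _ hx =>
      obtain ⟨n, hn⟩ := hx
      exact ⟨n, by rw [mul_neg]; exact R.neg_mem hn⟩
    | mul x y _ _ hx hy =>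
      obtain ⟨n, hn⟩ := hx
      obtain ⟨m, hm⟩ := hy
      refine ⟨n + m, ?_⟩
      rw [show a ^ (n + m) * (x * y) = (a ^ n * x) * (a ^ m * y) by ring]
      exact R.mul_mem hn hm
  intro x hx hx0
  obtain ⟨n, hn⟩ := key x hx
  have hpow : a ^ n ∈ nonZeroDivisors T := pow_mem (hR a ha ha0) n
  have hne : a ^ n * x ≠ 0 := fun h => hx0 ((mul_left_mem_nonZeroDivisors_eq_zero_iff hpow).1 h)
  exact (mul_mem_nonZeroDivisors.1 (hR _ hn hne)).2

theorem NonzeroRegular.closure_insert_of_mem {R : Subring T} (hR : R.NonzeroRegular) {t : T}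
    (ht : t ∈ R) : (closure (insert t (R : Set T))).NonzeroRegular :=
  hR.mono <| closure_le.2 <| Set.insert_subset ht subset_rfl

section Local

variable [IsNoetherianRing T] [IsLocalRing T]

theorem _root_.exists_mem_maximalIdeal_mem_nonZeroDivisors
    (hass : maximalIdeal T ∉ associatedPrimes T T) :
    ∃ z ∈ maximalIdeal T, z ∈ nonZeroDivisors T := by
  by_contra! hc
  have hsub : (maximalIdeal T : Set T) ⊆ ⋃ P ∈ associatedPrimes T T, (P : Set T) := by
    rw [biUnion_associatedPrimes_eq_compl_nonZeroDivisors]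
    exact fun z hz => hc z hz
  obtain ⟨P, hP, hle⟩ := (Ideal.subset_union_prime_finite (associatedPrimes.finite T T)
    (f := id) 0 0 fun _ hP _ _ => hP.isPrime).1 hsub
  exact hass (le_antisymm (le_maximalIdeal hP.isPrime.ne_top) hle ▸ hP)

/-- The candidates are t₀ + yG(u). A bad one is a root modulo some associated prime P of a nonzero f
over R. As R ∩ P = 0, f stays nonzero over the domain T/P, and y, z ∉ P make u ↦ t₀ + yG(u)
injective modulo P. Each pair (P, f) thus excludes finitely many u, and there are too few pairs. -/
theorem NonzeroRegular.exists_closure_insert [IsAdicComplete (maximalIdeal T) T]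
    (hass : maximalIdeal T ∉ associatedPrimes T T) {R : Subring T} (hR : R.NonzeroRegular)
    (hcard : max #R ℵ₀ < #(ℕ → T ⧸ maximalIdeal T)) {y : T} (hy : y ∈ nonZeroDivisors T)
    (t₀ : T) :
    ∃ t, t - t₀ ∈ Ideal.span {y} ∧ (closure (insert t (R : Set T))).NonzeroRegular := by
  classical
  obtain ⟨z, hzm, hz⟩ := exists_mem_maximalIdeal_mem_nonZeroDivisors hass
  obtain ⟨G, hG⟩ := exists_residueSeries hzm
  have hnot : ∀ P ∈ associatedPrimes T T, ∀ r ∈ nonZeroDivisors T, r ∉ P := by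
    intro P hP r hr hrP
    have : r ∈ (nonZeroDivisors T : Set T)ᶜ := by
      rw [← biUnion_associatedPrimes_eq_compl_nonZeroDivisors T]
      exact Set.mem_biUnion hP hrP
    exact this hr
  by_contra! hc
  have hbad : ∀ u, ∃ (P : associatedPrimes T T) (f : Polynomial R), f ≠ 0 ∧
      Polynomial.aeval (t₀ + y * G u) f ∈ P.1 := by
    intro u
    have h1 := hc (t₀ + y * G u) (by
      rw [add_sub_cancel_left]
      exact Ideal.mul_mem_right _ _ (Ideal.mem_span_singleton_self y))
    unfold NonzeroRegular at h1
    push Not at h1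
    obtain ⟨x, hx, hx0, hxn⟩ := h1
    obtain ⟨f, rfl⟩ := exists_aeval_of_mem_closure_insert hx
    have h2 : Polynomial.aeval (t₀ + y * G u) f ∈ (nonZeroDivisors T : Set T)ᶜ := hxn
    rw [← biUnion_associatedPrimes_eq_compl_nonZeroDivisors T] at h2
    simp only [Set.mem_iUnion] at h2
    obtain ⟨P, hP, h3⟩ := h2
    exact ⟨⟨P, hP⟩, f, by rintro rfl; simp at hx0, h3⟩
  choose P f hf hPf using hbad
  have hfib : ∀ b : associatedPrimes T T × Polynomial R,
      #((fun u => (P u, f u)) ⁻¹' {b}) ≤ ℵ₀ := by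
    rintro ⟨Q, g⟩
    by_cases hg : g = 0
    · have : ((fun u => (P u, f u)) ⁻¹' {(Q, g)}) = ∅ := by
        ext u
        simp only [Set.mem_preimage, Set.mem_singleton_iff, Prod.mk.injEq, Set.mem_empty_iff_false,
          iff_false, not_and]
        exact fun _ h => hf u (h.trans hg)
      simp [this]
    have hQ : Q.1.IsPrime := Q.2.isPrime
    let φ : R →+* T ⧸ Q.1 := (Ideal.Quotient.mk Q.1).comp R.subtype
    have hφ : Function.Injective φ := by
      rw [injective_iff_map_eq_zero]
      intro r hr
      by_contra hr0
      refine hnot Q.1 Q.2 r (hR r r.2 fun h => hr0 (Subtype.ext h)) ?_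
      exact Ideal.Quotient.eq_zero_iff_mem.1 hr
    have hg' : g.map φ ≠ 0 := (Polynomial.map_ne_zero_iff hφ).2 hg
    refine le_trans (mk_le_of_injective
      (f := fun u : ((fun u => (P u, f u)) ⁻¹' {(Q, g)}) =>
        (⟨Ideal.Quotient.mk Q.1 (t₀ + y * G u.1), ?_⟩ : ((g.map φ).roots.toFinset : Set (T ⧸ Q.1))))
      ?_) (mk_lt_aleph0).le
    · have hu : P u.1 = Q ∧ f u.1 = g := Prod.mk.inj u.2
      have h1 := hPf u.1
      rw [hu.1, hu.2] at h1
      rw [Finset.mem_coe, Multiset.mem_toFinset, Polynomial.mem_roots hg', Polynomial.IsRoot,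
        Polynomial.eval_map]
      have h2 := Ideal.Quotient.eq_zero_iff_mem.2 h1
      rwa [Polynomial.aeval_def, Polynomial.hom_eval₂] at h2
    · rintro ⟨u, hu⟩ ⟨v, hv⟩ huv
      have h1 := Ideal.Quotient.eq.1 (congrArg Subtype.val huv)
      rw [add_sub_add_left_eq_sub, ← mul_sub] at h1
      exact Subtype.ext (residueSeries_injective_mod hzm hG hQ (hnot _ Q.2 z hz)
        ((hQ.mem_or_mem h1).resolve_left (hnot _ Q.2 y hy)))
  have h1 := mk_le_mk_mul_of_mk_preimage_le (fun u => (P u, f u)) hfib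
  refine not_le.2 hcard (h1.trans ?_)
  have h2 : #(associatedPrimes T T) ≤ ℵ₀ := by
    have := (associatedPrimes.finite T T).to_subtype
    exact (mk_lt_aleph0).le
  rw [mk_prod, lift_id, lift_id]
  refine mul_le_of_le (le_max_right _ _) (mul_le_of_le (le_max_right _ _) ?_ ?_) (le_max_right _ _)
  · exact h2.trans (le_max_right _ _)
  · exact Polynomial.cardinalMk_le_max

end Local

/-- Zorn's lemma on graphs of partial choices of solutions: functionality of the graph bounds the
number of adjoined elements by |ι|. A maximal graph need not be total, but a requirement with no
solution in the resulting ring would allow an extension. -/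
theorem exists_nonzeroRegular_forall_exists_mem {R₀ : Subring T} (hR₀ : R₀.NonzeroRegular)
    {κ : Cardinal.{u}} (hκ : ℵ₀ ≤ κ) (hcard : #R₀ ≤ κ) {ι : Type u} (hι : #ι ≤ κ)
    (sol : ι → Set T)
    (step : ∀ i, ∀ R : Subring T, R₀ ≤ R → R.NonzeroRegular → #R ≤ κ →
      ∃ t ∈ sol i, (closure (insert t (R : Set T))).NonzeroRegular) :
    ∃ R : Subring T, R₀ ≤ R ∧ R.NonzeroRegular ∧ #R ≤ κ ∧ ∀ i, ∃ t ∈ R, t ∈ sol i := by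
  let S : Set (Set (ι × T)) := {G | (∀ p ∈ G, ∀ q ∈ G, p.1 = q.1 → p = q) ∧
    (∀ p ∈ G, p.2 ∈ sol p.1) ∧ (closure (R₀ ∪ Prod.snd '' G)).NonzeroRegular}
  have hempty : (∅ : Set (ι × T)) ∈ S := by
    refine ⟨by simp, by simp, ?_⟩
    simpa using hR₀
  obtain ⟨G, -, hmax⟩ := zorn_subset_nonempty S (fun c hcS hc hne => by
    refine ⟨⋃₀ c, ⟨?_, ?_, ?_⟩, fun s hs => Set.subset_sUnion_of_mem hs⟩
    · rintro p ⟨G, hG, hp⟩ q ⟨H, hH, hq⟩ hpq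
      rcases hc.total hG hH with h | h
      · exact (hcS hH).1 p (h hp) q hq hpq
      · exact (hcS hG).1 p hp q (h hq) hpq
    · rintro p ⟨G, hG, hp⟩
      exact (hcS hG).2.1 p hp
    · have key : ∀ x ∈ closure (R₀ ∪ Prod.snd '' ⋃₀ c),
          ∃ G ∈ c, x ∈ closure (R₀ ∪ Prod.snd '' G) := by
        have hdir : ∀ {x y : T}, (∃ G ∈ c, x ∈ closure (R₀ ∪ Prod.snd '' G)) →
            (∃ G ∈ c, y ∈ closure (R₀ ∪ Prod.snd '' G)) →
            ∃ G ∈ c, x ∈ closure (R₀ ∪ Prod.snd '' G) ∧ y ∈ closure (R₀ ∪ Prod.snd '' G) := by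
          rintro x y ⟨G, hG, hx⟩ ⟨H, hH, hy⟩
          rcases hc.total hG hH with h | h
          · exact ⟨H, hH, closure_mono (Set.union_subset_union_right _ (Set.image_mono h)) hx, hy⟩
          · exact ⟨G, hG, hx, closure_mono (Set.union_subset_union_right _ (Set.image_mono h)) hy⟩
        obtain ⟨G₀, hG₀⟩ := hne
        intro x hx
        induction hx using closure_induction with
        | mem x hx =>
          rcases hx with hx | ⟨p, ⟨G, hG, hp⟩, rfl⟩
          · exact ⟨G₀, hG₀, subset_closure (Or.inl hx)⟩
          · exact ⟨G, hG, subset_closure (Or.inr ⟨p, hp, rfl⟩)⟩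
        | zero => exact ⟨G₀, hG₀, zero_mem _⟩
        | one => exact ⟨G₀, hG₀, one_mem _⟩
        | add x y _ _ hx hy =>
          obtain ⟨G, hG, h1, h2⟩ := hdir hx hy
          exact ⟨G, hG, add_mem h1 h2⟩
        | neg x _ hx =>
          obtain ⟨G, hG, h1⟩ := hx
          exact ⟨G, hG, neg_mem h1⟩
        | mul x y _ _ hx hy =>
          obtain ⟨G, hG, h1, h2⟩ := hdir hx hy
          exact ⟨G, hG, mul_mem h1 h2⟩
      intro x hx
      obtain ⟨G, hG, hxG⟩ := key x hx
      exact (hcS hG).2.2 x hxG) ∅ hempty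
  obtain ⟨hG1, hG2, hG3⟩ := hmax.prop
  set R := closure (R₀ ∪ Prod.snd '' G) with hR
  have hRcard : #R ≤ κ := by
    refine (mk_closure_le _).trans (max_le ((mk_union_le _ _).trans (add_le_of_le hκ hcard ?_)) hκ)
    refine mk_image_le.trans (le_trans (mk_le_of_injective (f := fun p : G => p.1.1) ?_) hι)
    exact fun p q h => Subtype.ext (hG1 p p.2 q q.2 h)
  have hle : R₀ ≤ R := fun x hx => subset_closure (Or.inl hx)
  refine ⟨R, hle, hG3, hRcard, fun i => ?_⟩
  by_contra! hc
  obtain ⟨t, ht, htR⟩ := step i R hle hG3 hRcard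
  have hnew : ∀ p ∈ G, p.1 ≠ i := by
    rintro p hp rfl
    exact hc p.2 (subset_closure (Or.inr ⟨p, hp, rfl⟩)) (hG2 p hp)
  have hins : insert (i, t) G ∈ S := by
    refine ⟨?_, ?_, htR.mono ?_⟩
    · rintro p (rfl | hp) q (rfl | hq) hpq
      · rfl
      · exact absurd hpq.symm (hnew q hq)
      · exact absurd hpq (hnew p hp)
      · exact hG1 p hp q hq hpq
    · rintro p (rfl | hp)
      · exact ht
      · exact hG2 p hp
    · rw [closure_le]
      rintro x (hx | ⟨p, rfl | hp, rfl⟩)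
      · exact subset_closure (Or.inr (hle hx))
      · exact subset_closure (Or.inl rfl)
      · exact subset_closure (Or.inr (subset_closure (Or.inr ⟨p, hp, rfl⟩)))
  have hmem := hmax.le_of_ge hins (Set.subset_insert _ _) (Set.mem_insert _ _)
  exact hnew _ hmem rfl

end Subring

/-! ### Closing up under linear congruences -/

namespace Subring

variable {T : Type u} [CommRing T]

/-- Whenever `c ≡ a * t` modulo an ideal of `T` generated by finitely many elements of `A`, with
`a, c ∈ A`, the multiplier `t` can be chosen in `A`. -/
def LinearlyClosed (A : Subring T) : Prop :=
  ∀ c ∈ A, ∀ a ∈ A, ∀ s : Finset T, (s : Set T) ⊆ A →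
    (∃ t, c - a * t ∈ Ideal.span (s : Set T)) → ∃ t ∈ A, c - a * t ∈ Ideal.span (s : Set T)

section Construction

variable [IsNoetherianRing T] [IsLocalRing T] [IsAdicComplete (maximalIdeal T) T]

theorem NonzeroRegular.exists_extension (hass : maximalIdeal T ∉ associatedPrimes T T)
    {κ : Cardinal.{u}} (hκ : ℵ₀ ≤ κ) (hκlt : κ < #(ℕ → T ⧸ maximalIdeal T))
    {W : Set T} (hW : #W ≤ κ) {R₀ : Subring T} (hR₀ : R₀.NonzeroRegular) (hcard : #R₀ ≤ κ) :
    ∃ R : Subring T, R₀ ≤ R ∧ R.NonzeroRegular ∧ #R ≤ κ ∧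
      (∀ c ∈ R₀, ∀ a ∈ R₀, ∀ s : Finset T, (s : Set T) ⊆ R₀ →
        (∃ t, c - a * t ∈ Ideal.span (s : Set T)) →
          ∃ t ∈ R, c - a * t ∈ Ideal.span (s : Set T)) ∧
      ∀ w ∈ W, ∃ t ∈ R, t - w ∈ maximalIdeal T ^ 2 := by
  classical
  let ι := (R₀ × R₀ × Finset R₀) ⊕ W
  let J : Finset R₀ → Ideal T := fun s => Ideal.span (Subtype.val '' (s : Set R₀))
  -- An insoluble congruence imposes no condition.
  let sol : ι → Set T := Sum.elim
    (fun x => {t | (∃ t, (x.1 : T) - x.2.1 * t ∈ J x.2.2) → (x.1 : T) - x.2.1 * t ∈ J x.2.2})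
    (fun w => {t | t - w ∈ maximalIdeal T ^ 2})
  have hfin : #(Finset R₀) ≤ κ := by
    cases finite_or_infinite R₀
    · exact (mk_lt_aleph0 (α := Finset R₀)).le.trans hκ
    · rwa [mk_finset_of_infinite]
  have hι : #ι ≤ κ := by
    simp only [ι, mk_sum, mk_prod, lift_id]
    exact add_le_of_le hκ (mul_le_of_le hκ hcard (mul_le_of_le hκ hcard hfin)) hW
  obtain ⟨R, hle, hR, hRcard, hsol⟩ := exists_nonzeroRegular_forall_exists_mem hR₀ hκ hcard hι sol (by
    rintro (⟨c, a, s⟩ | w) R hle hR hRcard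
    · by_cases hex : ∃ t, (c : T) - a * t ∈ J s
      · obtain ⟨t₀, ht₀⟩ := hex
        -- With a nonzero, hence regular, generator y, a solution may be moved by multiples of y to
        -- a generic one. Otherwise c = at holds exactly and t is a fraction over R, or 0 works when
        -- a = 0.
        by_cases hs : ∃ y ∈ s, y ≠ 0
        · obtain ⟨y, hys, hy0⟩ := hs
          have hy : (y : T) ∈ nonZeroDivisors T := hR₀ y y.2 fun h => hy0 (Subtype.ext h)
          obtain ⟨t, ht, htR⟩ := hR.exists_closure_insert hass
            ((max_le hRcard hκ).trans_lt hκlt) hy t₀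
          refine ⟨t, fun _ => ?_, htR⟩
          have hyJ : (y : T) ∈ J s := Ideal.subset_span ⟨y, hys, rfl⟩
          have h1 := (Ideal.span_singleton_le_iff_mem _).2 hyJ ht
          have h2 := sub_mem ht₀ (Ideal.mul_mem_left _ (a : T) h1)
          change (c : T) - a * t ∈ J s
          convert h2 using 1
          ring
        · push Not at hs
          have hJ : J s = ⊥ := by
            refine Ideal.span_eq_bot.2 ?_
            rintro _ ⟨y, hy, rfl⟩
            simp [hs y hy]
          have heq : (c : T) = a * t₀ := by
            rw [hJ] at ht₀
            exact sub_eq_zero.1 ht₀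
          by_cases ha : (a : T) = 0
          · refine ⟨0, fun _ => ?_, hR.closure_insert_of_mem R.zero_mem⟩
            change (c : T) - a * 0 ∈ J s
            simp [heq, ha]
          · exact ⟨t₀, fun _ => ht₀,
              hR.closure_insert_of_mul_mem (hle a.2) ha (heq ▸ hle c.2)⟩
      · exact ⟨0, fun h => absurd h hex, hR.closure_insert_of_mem R.zero_mem⟩
    · obtain ⟨z, hzm, hz⟩ := exists_mem_maximalIdeal_mem_nonZeroDivisors hass
      obtain ⟨t, ht, htR⟩ := hR.exists_closure_insert hass
        ((max_le hRcard hκ).trans_lt hκlt) (pow_mem hz 2) w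
      exact ⟨t, (Ideal.span_singleton_le_iff_mem _).2 (Ideal.pow_mem_pow hzm 2) ht, htR⟩)
  refine ⟨R, hle, hR, hRcard, fun c hc a ha s hs hex => ?_, fun w hw => hsol (Sum.inr ⟨w, hw⟩)⟩
  obtain ⟨t, htR, ht⟩ := hsol (Sum.inl (⟨c, hc⟩, ⟨a, ha⟩, s.subtype (· ∈ R₀)))
  have hJ : J (s.subtype (· ∈ R₀)) = Ideal.span (s : Set T) := by
    refine congrArg Ideal.span (Set.ext fun x => ?_)
    simpa using fun h => hs h
  refine ⟨t, htR, ?_⟩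
  change (∃ t, c - a * t ∈ J (s.subtype (· ∈ R₀))) → c - a * t ∈ J (s.subtype (· ∈ R₀)) at ht
  rw [hJ] at ht
  exact ht hex

/-- Countably many extensions suffice: a congruence involves finitely many elements, so it lives at
one stage and is solved at the next. -/
theorem NonzeroRegular.exists_linearly_closed (hass : maximalIdeal T ∉ associatedPrimes T T)
    {κ : Cardinal.{u}} (hκ : ℵ₀ ≤ κ) (hκlt : κ < #(ℕ → T ⧸ maximalIdeal T))
    {W : Set T} (hW : #W ≤ κ) {R₀ : Subring T} (hR₀ : R₀.NonzeroRegular) (hcard : #R₀ ≤ κ) :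
    ∃ A : Subring T, A.NonzeroRegular ∧ #A ≤ κ ∧
      A.LinearlyClosed ∧
      ∀ w ∈ W, ∃ t ∈ A, t - w ∈ maximalIdeal T ^ 2 := by
  choose! next hle hreg hnext hlin hW' using fun (R : Subring T) (h : R.NonzeroRegular ∧ #R ≤ κ) =>
    h.1.exists_extension hass hκ hκlt hW h.2
  obtain ⟨S, hS0, hS1⟩ : ∃ S : ℕ → Subring T, S 0 = R₀ ∧ ∀ n, S (n + 1) = next (S n) :=
    ⟨fun n => Nat.rec R₀ (fun _ R => next R) n, rfl, fun _ => rfl⟩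
  have hS : ∀ n, (S n).NonzeroRegular ∧ #(S n) ≤ κ := by
    intro n
    induction n with
    | zero => exact hS0 ▸ ⟨hR₀, hcard⟩
    | succ n ih => exact hS1 n ▸ ⟨hreg _ ih, hnext _ ih⟩
  have hmono : Monotone S := monotone_nat_of_le_succ fun n => hS1 n ▸ hle _ (hS n)
  have hmem : ∀ {x : T}, x ∈ ⨆ n, S n ↔ ∃ n, x ∈ S n :=
    Subring.mem_iSup_of_directed hmono.directed_le
  have hfin : ∀ s : Finset T, (s : Set T) ⊆ (⨆ n, S n : Subring T) →
      ∃ n, (s : Set T) ⊆ S n := by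
    classical
    intro s
    induction s using Finset.induction_on with
    | empty => exact fun _ => ⟨0, by simp⟩
    | insert x s _ ih =>
      intro h
      rw [Finset.coe_insert, Set.insert_subset_iff] at h
      obtain ⟨n, hn⟩ := ih h.2
      obtain ⟨m, hm⟩ := hmem.1 h.1
      refine ⟨max n m, ?_⟩
      rw [Finset.coe_insert, Set.insert_subset_iff]
      exact ⟨hmono (le_max_right n m) hm, hn.trans (hmono (le_max_left n m))⟩
  refine ⟨⨆ n, S n, ?_, ?_, ?_, ?_⟩
  · intro r hr
    obtain ⟨n, hn⟩ := hmem.1 hr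
    exact (hS n).1 r hn
  · have h1 : ((⨆ n, S n : Subring T) : Set T) = ⋃ n : ULift.{u} ℕ, (S n.down : Set T) := by
      ext x
      simp [hmem]
    have h2 : #(⨆ n, S n : Subring T) = #(⋃ n : ULift.{u} ℕ, (S n.down : Set T)) :=
      mk_congr (Equiv.setCongr h1)
    rw [h2]
    refine (mk_iUnion_le _).trans (mul_le_of_le hκ (by simpa using hκ) ?_)
    exact ciSup_le' fun n => (hS n.down).2
  · intro c hc a ha s hs hex
    obtain ⟨n, hn⟩ := hmem.1 hc
    obtain ⟨m, hm⟩ := hmem.1 ha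
    obtain ⟨l, hl⟩ := hfin s hs
    let N := max n (max m l)
    obtain ⟨t, ht, h⟩ := hlin (S N) (hS N) c (hmono (le_max_left _ _) hn) a
      (hmono ((le_max_left m l).trans (le_max_right n _)) hm) s
      (hl.trans (hmono ((le_max_right m l).trans (le_max_right n _)))) hex
    exact ⟨t, hmem.2 ⟨N + 1, hS1 N ▸ ht⟩, h⟩
  · intro w hw
    obtain ⟨t, ht, h⟩ := hW' (S 0) (hS 0) w hw
    exact ⟨t, hmem.2 ⟨1, hS1 0 ▸ ht⟩, h⟩

end Construction

/-- Induction on the generators used: in c = ta + z with z in the span of the others, t may be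
replaced by some t' ∈ A, and c - at' needs one generator fewer. -/
theorem comap_map_subtype_eq_of_linearly_closed {A : Subring T}
    (hA : A.LinearlyClosed) (I : Ideal A) :
    (I.map A.subtype).comap A.subtype = I := by
  classical
  have key : ∀ (s : Finset T), (∀ x ∈ s, ∃ y ∈ I, (y : T) = x) → ∀ c : A,
      (c : T) ∈ Ideal.span (s : Set T) → c ∈ I := by
    intro s
    induction s using Finset.induction_on with
    | empty =>
      intro _ c hc
      have : c = 0 := Subtype.ext (by simpa using hc)
      exact this ▸ I.zero_mem
    | insert a s _ ih =>
      intro hs c hc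
      obtain ⟨b, hb, hba⟩ := hs a (Finset.mem_insert_self _ _)
      have hs' := fun x hx => hs x (Finset.mem_insert_of_mem hx)
      rw [Finset.coe_insert] at hc
      obtain ⟨t, z, hz, hcz⟩ := Ideal.mem_span_insert.1 hc
      obtain ⟨t', ht', h⟩ := hA c c.2 a (hba ▸ b.2) s
        (fun x hx => by obtain ⟨y, -, rfl⟩ := hs' x hx; exact y.2)
        ⟨t, by rwa [hcz, mul_comm, add_sub_cancel_left]⟩
      have h1 : c - b * ⟨t', ht'⟩ ∈ I := ih hs' _ (by simpa [hba] using h)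
      have := add_mem h1 (I.mul_mem_right ⟨t', ht'⟩ hb)
      rwa [sub_add_cancel] at this
  refine le_antisymm (fun c hc => ?_) Ideal.le_comap_map
  obtain ⟨s, hs, hcs⟩ := Submodule.mem_span_finite_of_mem_span (Ideal.mem_comap.1 hc)
  exact key s (fun x hx => hs hx) c hcs

end Subring

/-! ### Recovering T as the completion of A -/

/-- The hypotheses make every A/Iⁿ → T/Jⁿ bijective; pass to the limit. -/
theorem nonempty_adicCompletion_ringEquiv {A T : Type*} [CommRing A] [CommRing T] (φ : A →+* T)
    (I : Ideal A) (J : Ideal T) [IsAdicComplete J T] (hcomap : ∀ n, (J ^ n).comap φ = I ^ n)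
    (hsurj : ∀ n t, ∃ a, t - φ a ∈ J ^ n) : Nonempty (AdicCompletion I A ≃+* T) := by
  let f : ∀ n, AdicCompletion I A →+* T ⧸ J ^ n := fun n =>
    (Ideal.quotientMap (J ^ n) φ (hcomap n).ge).comp (AdicCompletion.evalₐ I n).toRingHom
  have hmk : ∀ n (a : AdicCompletion.AdicCauchySequence I A),
      f n (AdicCompletion.mk I A a) = Ideal.Quotient.mk (J ^ n) (φ (a n)) := by
    intro n a
    simp only [f, RingHom.comp_apply]
    erw [AdicCompletion.evalₐ_mk]
    simp
  have hf : ∀ {m n : ℕ} (hle : m ≤ n), (Ideal.Quotient.factorPow J hle).comp (f n) = f m := by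
    intro m n hle
    ext x
    induction x using AdicCompletion.induction_on with | _ a =>
    rw [RingHom.comp_apply, hmk, hmk]
    simp only [Ideal.Quotient.factor_mk]
    rw [Ideal.Quotient.eq, ← map_sub, ← Ideal.mem_comap, hcomap]
    have := (a.2 hle).symm
    rw [SModEq.sub_mem, smul_eq_mul, Ideal.mul_top] at this
    exact this
  let g := IsAdicComplete.liftRingHom J f hf
  have hg : ∀ n x, Ideal.Quotient.mk (J ^ n) (g x) = f n x :=
    fun n x => IsAdicComplete.mk_liftRingHom J f hf n x
  refine ⟨RingEquiv.ofBijective g ⟨(injective_iff_map_eq_zero g).2 fun x hx => ?_, fun t => ?_⟩⟩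
  · refine AdicCompletion.ext_evalₐ fun n => ?_
    have h1 := hg n x
    rw [hx, map_zero] at h1
    have hinj : Function.Injective (Ideal.quotientMap (J ^ n) φ (hcomap n).ge) :=
      Ideal.quotientMap_injective' (hcomap n).le
    rw [map_zero]
    exact (map_eq_zero_iff _ hinj).1 h1.symm
  · choose a ha using fun n => hsurj n t
    let b : AdicCompletion.AdicCauchySequence I A := AdicCompletion.AdicCauchySequence.mk I A a (by
      intro n
      rw [SModEq.sub_mem, smul_eq_mul, Ideal.mul_top, ← hcomap, Ideal.mem_comap, map_sub]
      have := sub_mem (Ideal.pow_le_pow_right n.le_succ (ha (n + 1))) (ha n)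
      rwa [sub_sub_sub_cancel_left] at this)
    refine ⟨AdicCompletion.mk I A b, ?_⟩
    refine IsHausdorff.eq_iff_smodEq (I := J).2 fun n => ?_
    rw [SModEq.sub_mem, smul_eq_mul, Ideal.mul_top, ← Ideal.Quotient.eq, hg, hmk,
      Ideal.Quotient.eq, ← neg_sub, neg_mem_iff]
    exact ha n

section Descent

variable {T : Type u} [CommRing T] {A : Subring T}

/-- Extension of ideals is injective, so ascending chains of A are detected in T. -/
theorem Subring.isNoetherianRing_of_comap_map_eq [IsNoetherianRing T]
    (hA : ∀ I : Ideal A, (I.map A.subtype).comap A.subtype = I) : IsNoetherianRing A := by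
  have hinj : Function.Injective (Ideal.map A.subtype) := fun I J h => by
    rw [← hA I, ← hA J, h]
  have hmono : StrictMono (Ideal.map A.subtype) :=
    Monotone.strictMono_of_injective (fun I J h => Ideal.map_mono h) hinj
  have : WellFoundedGT (Ideal A) := hmono.wellFoundedGT
  exact isNoetherianRing_iff.2 (isNoetherian_iff'.2 this)

theorem Subring.isLocalHom_subtype_of_comap_map_eq
    (hA : ∀ I : Ideal A, (I.map A.subtype).comap A.subtype = I) : IsLocalHom A.subtype := by
  refine ⟨fun a ha => ?_⟩
  rw [← Ideal.span_singleton_eq_top, ← hA (Ideal.span {a}), Ideal.map_span, Set.image_singleton,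
    Ideal.span_singleton_eq_top.2 ha, Ideal.comap_top]

theorem Subring.nonempty_adicCompletion_ringEquiv [IsNoetherianRing T] [IsLocalRing T]
    [IsAdicComplete (maximalIdeal T) T] [IsLocalRing A] [IsLocalHom A.subtype]
    (hA : ∀ I : Ideal A, (I.map A.subtype).comap A.subtype = I)
    {W : Set T} (hWM : maximalIdeal T ≤ Ideal.span (W ∩ maximalIdeal T))
    (hWres : ∀ t, ∃ w ∈ W, t - w ∈ maximalIdeal T)
    (hW : ∀ w ∈ W, ∃ t ∈ A, t - w ∈ maximalIdeal T ^ 2) :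
    Nonempty (AdicCompletion (maximalIdeal A) A ≃+* T) := by
  have hle : (maximalIdeal A).map A.subtype ≤ maximalIdeal T :=
    Ideal.map_le_iff_le_comap.2 (maximalIdeal_comap A.subtype).ge
  have hmap : (maximalIdeal A).map A.subtype = maximalIdeal T := by
    -- Approximating generators of M modulo M² gives M ⊆ 𝔪T + M², so Nakayama applies; this is why
    -- the elements of W are matched to second order.
    refine le_antisymm hle (Submodule.le_of_le_smul_of_le_jacobson_bot
      (maximalIdeal T).fg_of_isNoetherianRing (maximalIdeal_le_jacobson ⊥) ?_)
    refine hWM.trans (Ideal.span_le.2 ?_)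
    rintro w ⟨hw, hwM⟩
    obtain ⟨t, htA, ht⟩ := hW w hw
    have htM : t ∈ maximalIdeal T := by
      have := add_mem (Ideal.pow_le_self two_ne_zero ht) hwM
      rwa [sub_add_cancel] at this
    have h1 : t ∈ (maximalIdeal A).map A.subtype := by
      refine Ideal.mem_map_of_mem A.subtype (x := ⟨t, htA⟩) ?_
      rw [mem_maximalIdeal, mem_nonunits_iff]
      exact fun hu => (mem_maximalIdeal _).1 htM (hu.map A.subtype)
    have h2 := sub_mem (Ideal.mem_sup_left h1) (Ideal.mem_sup_right ht)
    rwa [sub_sub_cancel, pow_two] at h2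
  refine _root_.nonempty_adicCompletion_ringEquiv A.subtype (maximalIdeal A) (maximalIdeal T)
    (fun n => by rw [← hmap, ← Ideal.map_pow, hA]) fun n t => ?_
  obtain ⟨b, hb, h⟩ := A.exists_sub_mem_pow (s := A.subtype '' (maximalIdeal A : Set A))
    (by rintro _ ⟨a, -, rfl⟩; exact a.2) hmap (fun t => by
      obtain ⟨w, hw, htw⟩ := hWres t
      obtain ⟨a, ha, haw⟩ := hW w hw
      refine ⟨a, ha, ?_⟩
      have := sub_mem htw (Ideal.pow_le_self two_ne_zero haw)
      rwa [sub_sub_sub_cancel_right] at this) n t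
  exact ⟨⟨b, hb⟩, h⟩

end Descent

/-! ### Sufficiency and the equivalence -/

theorem exists_domain_mk_primeSpectrum_lt {T : Type u} [CommRing T] [IsNoetherianRing T]
    [IsLocalRing T] [IsAdicComplete (maximalIdeal T) T] (hdim : 2 ≤ ringKrullDim T)
    (hint : ∀ n : ℤ, (n : T) ≠ 0 → (n : T) ∈ nonZeroDivisors T)
    (hass : maximalIdeal T ∉ associatedPrimes T T) (hres : #(T ⧸ maximalIdeal T) < #T) :
    ∃ (A : Type u) (_ : CommRing A) (_ : IsDomain A) (_ : IsNoetherianRing A)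
      (_ : IsLocalRing A), Nonempty (AdicCompletion (maximalIdeal A) A ≃+* T) ∧
        #(PrimeSpectrum A) < #(PrimeSpectrum T) := by
  set κ := max #(T ⧸ maximalIdeal T) ℵ₀
  have hκ : ℵ₀ ≤ κ := le_max_right _ _
  have hκlt : κ < #(ℕ → T ⧸ maximalIdeal T) := mk_residue_sup_aleph0_lt_mk_sequences hres
  obtain ⟨s, hs⟩ := (maximalIdeal T).fg_of_isNoetherianRing
  let W : Set T := Set.range (Quotient.out : T ⧸ maximalIdeal T → T) ∪ s
  have hW : #W ≤ κ := by
    refine (mk_union_le _ _).trans (add_le_of_le hκ (mk_range_le.trans (le_max_left _ _)) ?_)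
    exact (mk_lt_aleph0 (α := (s : Set T))).le.trans hκ
  -- Condition (i) says precisely that the prime subring is an admissible start.
  have hbot : (⊥ : Subring T).NonzeroRegular := by
    intro r hr hr0
    obtain ⟨n, rfl⟩ := Subring.mem_bot.1 hr
    exact hint n hr0
  have hbotcard : #(⊥ : Subring T) ≤ κ := by
    rw [← Subring.closure_empty]
    exact (Subring.mk_closure_le _).trans (max_le (by simp) hκ)
  obtain ⟨A, hreg, hcard, hlin, hAW⟩ := hbot.exists_linearly_closed hass hκ hκlt hW hbotcard
  have hA := Subring.comap_map_subtype_eq_of_linearly_closed hlin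
  have hnoeth : IsNoetherianRing A := Subring.isNoetherianRing_of_comap_map_eq hA
  have hlocal : IsLocalHom A.subtype := Subring.isLocalHom_subtype_of_comap_map_eq hA
  have hlr : IsLocalRing A := RingHom.domain_isLocalRing A.subtype
  have hdom : IsDomain A := by
    have : NoZeroDivisors A := ⟨fun {a b} hab => by
      by_contra! hc
      refine hc.2 (Subtype.ext ?_)
      have ha := hreg a a.2 fun h => hc.1 (Subtype.ext h)
      exact (mul_left_mem_nonZeroDivisors_eq_zero_iff ha).1 (congrArg Subtype.val hab)⟩
    exact NoZeroDivisors.to_isDomain A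
  refine ⟨A, inferInstance, hdom, hnoeth, hlr, ?_, ?_⟩
  · refine Subring.nonempty_adicCompletion_ringEquiv hA (W := W) ?_ ?_ hAW
    · conv_lhs => rw [← hs]
      exact Ideal.span_mono fun x hx => ⟨Or.inr hx, hs ▸ Ideal.subset_span hx⟩
    · exact fun t => ⟨(Ideal.Quotient.mk (maximalIdeal T) t).out, Or.inl ⟨_, rfl⟩,
        Ideal.Quotient.eq.1 (Quotient.out_eq (Ideal.Quotient.mk (maximalIdeal T) t)).symm⟩
  · exact (mk_primeSpectrum_le_max.trans (max_le hcard hκ)).trans_lt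
      (hκlt.trans_le (mk_residue_sequences_le_mk_primeSpectrum hdim))

theorem theorem3p6 {T : Type u} [CommRing T] [IsNoetherianRing T] [IsLocalRing T]
    [IsAdicComplete (IsLocalRing.maximalIdeal T) T] (hdim : 2 ≤ ringKrullDim T) :
    (∃ (A : Type u) (_ : CommRing A) (_ : IsDomain A) (_ : IsNoetherianRing A)
        (_ : IsLocalRing A),
        Nonempty (AdicCompletion (IsLocalRing.maximalIdeal A) A ≃+* T) ∧
        Cardinal.mk (PrimeSpectrum A) < Cardinal.mk (PrimeSpectrum T)) ↔
      ((∀ n : ℤ, (n : T) ≠ 0 → (n : T) ∈ nonZeroDivisors T) ∧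
        IsLocalRing.maximalIdeal T ∉ associatedPrimes T T ∧
        Cardinal.mk (T ⧸ IsLocalRing.maximalIdeal T) < Cardinal.mk T) := by
  constructor
  · rintro ⟨A, _, _, _, _, ⟨e⟩, hlt⟩
    exact residue_lt_of_mk_primeSpectrum_lt hdim
      (e.toRingHom.comp (algebraMap A (AdicCompletion (maximalIdeal A) A)))
      (map_maximalIdeal_of_adicCompletion_equiv e)
      (fun a ha => mem_nonZeroDivisors_of_adicCompletion_equiv _ e ha)
      (mk_residue_eq_of_adicCompletion_equiv e) hlt
  · rintro ⟨hint, hass, hres⟩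
    exact exists_domain_mk_primeSpectrum_lt hdim hint hass hres
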